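/- For a group $G$ and an automorphism $\phi$ of $G$, call $x,x'\in G$ $\phi$-conjugate if $x'=gx\phi(g^{-1})$ for some $g\in G$, and let $R(\phi)$, the Reidemeister number, be the number of $\phi$-conjugacy classes. Let $\widehat G_f$ be the set of unitary equivalence classes of finite-dimensional irreducible unitary representations of $G$, and let $S_f(\phi)$ be the number of fixed points of the map $\widehat G_f\to\widehat G_f$, $[\rho]\mapsto[\rho\circ\phi]$. The group $G$ has the RP property if for every automorphism $\phi$ of $G$ with $R(\phi)<\infty$ there are a finite group $K$, an automorphism $\psi$ of $K$ and an epimorphism $F:G\to K$ with $F\circ\phi=\psi\circ F$ such that every $\phi$-conjugacy class is the preimage under $F$ of a subset of $K$. Theorem. Let $A$ be a finitely generated abelian group and let $A\wr\mathbb Z=\bigl(\bigoplus_{i\in\mathbb Z}A_i\bigr)\rtimes\mathbb Z$, where every $A_i$ is a copy of $A$ and $b\in\mathbb Z$ acts by $b\cdot A_i=A_{b+i}$. Then $A\wr\mathbb Z$ has the RP property, and for every automorphism $\phi$ of $A\wr\mathbb Z$ with $R(\phi)<\infty$ one has $R(\phi)=S_f(\phi)$. -/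

import Mathlib

section Twisted

variable {G : Type*} [Group G]

/-- Twisted conjugacy for an automorphism `φ`: `x'` and `x` are `φ`-conjugate if
`x' = g x φ(g⁻¹)` for some `g`. -/
def twistedConj (φ : MulAut G) : Setoid G where
  r x x' := ∃ g : G, x' = g * x * φ g⁻¹
  iseqv :=
    { refl := fun x => ⟨1, by simp⟩
      symm := by
        rintro x _ ⟨g, rfl⟩
        exact ⟨g⁻¹, by simp [mul_assoc]⟩
      trans := by
        rintro x _ _ ⟨g, rfl⟩ ⟨h, rfl⟩
        exact ⟨h * g, by simp [mul_assoc]⟩ }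

/-- The set of `φ`-conjugacy classes. -/
abbrev ReidemeisterClasses (φ : MulAut G) : Type _ := Quotient (twistedConj φ)

/-- The Reidemeister number `R(φ)`, the number of `φ`-conjugacy classes (`⊤` if infinite). -/
noncomputable def reidemeisterNumber (φ : MulAut G) : ℕ∞ := ENat.card (ReidemeisterClasses φ)

end Twisted

section RP

/-- The RP property: for every automorphism `φ` with finite Reidemeister number the
characteristic functions of the `φ`-conjugacy classes are periodic, that is, there are an
epimorphism `F` onto a finite group `K` and an automorphism `ψ` of `K` with `F ∘ φ = ψ ∘ F` such
that every `φ`-conjugacy class is the preimage under `F` of a subset of `K`. -/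
def IsRPGroup (G : Type*) [Group G] : Prop :=
  ∀ φ : MulAut G, reidemeisterNumber φ ≠ ⊤ →
    ∃ (K : Type) (_ : Group K) (_ : Finite K) (ψ : MulAut K) (F : G →* K),
      Function.Surjective F ∧ (∀ g, F (φ g) = ψ (F g)) ∧
        ∀ c : ReidemeisterClasses φ, ∃ S : Set K, {x : G | Quotient.mk (twistedConj φ) x = c} = F ⁻¹' S

end RP

section Dual

/-- A unitary representation of `G` on a Euclidean space `ℂⁿ`; up to unitary equivalence, these
are all the finite-dimensional unitary representations. -/
abbrev UnitaryRep (G : Type*) [Group G] (n : ℕ) : Type _ :=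
  G →* (EuclideanSpace ℂ (Fin n) ≃ₗᵢ[ℂ] EuclideanSpace ℂ (Fin n))

/-- The linear representation underlying a unitary representation. -/
noncomputable def UnitaryRep.toRepresentation {G : Type*} [Group G] {n : ℕ} (ρ : UnitaryRep G n) :
    Representation ℂ G (EuclideanSpace ℂ (Fin n)) where
  toFun g := (ρ g).toLinearEquiv.toLinearMap
  map_one' := by ext1 x; simp
  map_mul' g h := by ext1 x; simp

/-- A finite-dimensional irreducible unitary representation of `G`. -/
structure UnitaryIrrep (G : Type*) [Group G] where
  /-- the dimension -/
  dim : ℕ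
  /-- the representation -/
  rep : UnitaryRep G dim
  irreducible : rep.toRepresentation.IsIrreducible

variable {G : Type*} [Group G]

/-- Unitary equivalence of finite-dimensional irreducible unitary representations. -/
def unitaryEquivalence (G : Type*) [Group G] : Setoid (UnitaryIrrep G) where
  r ρ σ := ∃ T : EuclideanSpace ℂ (Fin ρ.dim) ≃ₗᵢ[ℂ] EuclideanSpace ℂ (Fin σ.dim),
    ∀ (g : G) (x : EuclideanSpace ℂ (Fin ρ.dim)), T (ρ.rep g x) = σ.rep g (T x)
  iseqv :=
    { refl := fun ρ => ⟨LinearIsometryEquiv.refl ℂ _, fun _ _ => rfl⟩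
      symm := by
        rintro ρ σ ⟨T, hT⟩
        refine ⟨T.symm, fun g x => ?_⟩
        apply T.injective
        simp [hT]
      trans := by
        rintro ρ σ τ ⟨T, hT⟩ ⟨U, hU⟩
        exact ⟨T.trans U, fun g x => by simp [hT, hU]⟩ }

/-- The set of unitary equivalence classes of finite-dimensional irreducible unitary
representations of `G`. -/
abbrev FinUnitaryDual (G : Type*) [Group G] : Type _ := Quotient (unitaryEquivalence G)

/-- Precomposition with an automorphism preserves the lattice of subrepresentations. -/
def subrepresentationComp {n : ℕ} (φ : MulAut G) (ρ : UnitaryRep G n) :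
    Subrepresentation ρ.toRepresentation ≃o
      Subrepresentation (UnitaryRep.toRepresentation (ρ.comp φ.toMonoidHom)) where
  toFun W := ⟨W.toSubmodule, fun g _ hv => W.apply_mem_toSubmodule (φ g) hv⟩
  invFun W := ⟨W.toSubmodule, fun g v hv => by
    have h := W.apply_mem_toSubmodule (φ.symm g) hv
    simpa [UnitaryRep.toRepresentation] using h⟩
  left_inv _ := rfl
  right_inv _ := rfl
  map_rel_iff' := Iff.rfl

/-- The representation `ρ ∘ φ`. -/
noncomputable def UnitaryIrrep.comp (ρ : UnitaryIrrep G) (φ : MulAut G) : UnitaryIrrep G where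
  dim := ρ.dim
  rep := ρ.rep.comp φ.toMonoidHom
  irreducible :=
    (OrderIso.isSimpleOrder_iff (subrepresentationComp φ ρ.rep)).mp ρ.irreducible

/-- The map of the finite-dimensional unitary dual induced by `φ`, sending the class of `ρ` to the
class of `ρ ∘ φ`. -/
noncomputable def dualMap (φ : MulAut G) : FinUnitaryDual G → FinUnitaryDual G :=
  Quotient.map (sa := unitaryEquivalence G) (sb := unitaryEquivalence G) (fun ρ => ρ.comp φ) (by
    rintro ρ σ ⟨T, hT⟩
    exact ⟨T, fun g x => hT (φ g) x⟩)

/-- The number `S_f(φ)` of fixed points of the map induced by `φ` on the finite-dimensional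
unitary dual (`⊤` if infinite). -/
noncomputable def fixedIrrepNumber (φ : MulAut G) : ℕ∞ :=
  ENat.card (Function.fixedPoints (dualMap φ))

end Dual

section Wreath

/-- The action of `B` on `⨁_{i ∈ B} A` by `b · A_i = A_{b i}`, written multiplicatively. -/
noncomputable def wreathAction (A B : Type*) [AddCommGroup A] [Group B] :
    B →* MulAut (Multiplicative (B →₀ A)) where
  toFun b := AddEquiv.toMultiplicative (Finsupp.domCongr (Equiv.mulLeft b))
  map_one' := by
    apply MulEquiv.ext
    intro f
    apply Finsupp.ext
    intro i
    change f.toAdd ((1 : B)⁻¹ * i) = f.toAdd i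
    simp
  map_mul' b c := by
    apply MulEquiv.ext
    intro f
    apply Finsupp.ext
    intro i
    change f.toAdd ((b * c)⁻¹ * i) = f.toAdd (c⁻¹ * (b⁻¹ * i))
    simp [mul_assoc]

/-- The (restricted) wreath product `A ≀ B = (⨁_{i ∈ B} A) ⋊ B` of an abelian group `A`, written
additively, with a group `B`. -/
abbrev WreathProduct (A B : Type*) [AddCommGroup A] [Group B] : Type _ :=
  Multiplicative (B →₀ A) ⋊[wreathAction A B] B

end Wreath

/-!
Write `Γ = ⨁ A`, let `t` be the unit shift of `Γ`, and let `φ` be an automorphism of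
`A ≀ ℤ = Γ ⋊ ℤ` with `R(φ) < ∞`.

*The RP property.* `Γ` is invariant under `φ`: if the abelian normal subgroup `φ(Γ)` contained some
`(z, n)` with `n ≠ 0`, it would have to commute with its own commutators, so the injective operator
`(1 - tⁿ)²` would kill `Γ` (`IntSemidirect.right_apply_el_zero`). As the identity of
`ℤ` has infinitely many twisted conjugacy classes, `φ` induces `-1` on `ℤ`
(`IntSemidirect.exists_components`). So `p = φ|Γ` satisfies `p t = t⁻¹ p`; in particular `p`
commutes with `s = t + t⁻¹`, although in general not with `t`. The classes inside `Γ × {k}` are the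
cosets of the image of `1 - tᵏ p`, which is therefore an `s`-stable subgroup of finite index. Since `Γ` is finitely generated over `ℤ[s]`,
these images contain a common subgroup `nΓ + (sᵃ - sᵇ)Γ` of finite index, and that subgroup is
stable under everything commuting with `s`, hence under `t` and `p`
(`exists_finite_quotient_le_of_commute`). It is extended to a normal finite-index subgroup
`{(x, k) : x ∈ M, m ∣ k}` of `Γ ⋊ ℤ` whose translations preserve all `φ`-conjugacy classes
(`IntSemidirect.isRPGroup`).

*The equality.* If `T` intertwines an irreducible `ρ` with `ρ ∘ φ`, then `x ↦ tr (T ρ(x))` is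
constant on `φ`-conjugacy classes. By Burnside's theorem these functions are linearly independent
for inequivalent `ρ`, so `S_f(φ) ≤ R(φ)` for every group. On a finite group `K` with automorphism
`ψ`, a twisted class function orthogonal to all of them is killed by every irreducible
representation, by Schur's lemma, hence is zero, so `R(ψ) ≤ S_f(ψ)`. For the finite quotient `K`
provided by the RP property, inflation of representations gives
`R(φ) ≤ R(ψ) ≤ S_f(ψ) ≤ S_f(φ) ≤ R(φ)`.
-/

/-! ### Schur's lemma for unitary representations -/

namespace UnitaryIrrep

variable {G : Type*} [Group G]

lemma eq_bot_or_eq_top (ρ : UnitaryIrrep G) (W : Submodule ℂ (EuclideanSpace ℂ (Fin ρ.dim)))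
    (hW : ∀ g, ∀ x ∈ W, ρ.rep g x ∈ W) : W = ⊥ ∨ W = ⊤ := by
  have := ρ.irreducible
  let S : Subrepresentation ρ.rep.toRepresentation := ⟨W, fun g x hx => hW g x hx⟩
  rcases IsSimpleOrder.eq_bot_or_eq_top S with h | h
  · exact Or.inl (congrArg Subrepresentation.toSubmodule h)
  · exact Or.inr (congrArg Subrepresentation.toSubmodule h)

instance (ρ : UnitaryIrrep G) : Nontrivial (EuclideanSpace ℂ (Fin ρ.dim)) := by
  have := ρ.irreducible
  by_contra h
  rw [not_nontrivial_iff_subsingleton] at h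
  apply bot_ne_top (α := Subrepresentation ρ.rep.toRepresentation)
  apply Subrepresentation.toSubmodule_injective
  exact Subsingleton.elim _ _

lemma exists_eq_smul_of_commute (ρ : UnitaryIrrep G)
    (P : EuclideanSpace ℂ (Fin ρ.dim) →ₗ[ℂ] EuclideanSpace ℂ (Fin ρ.dim))
    (hP : ∀ g x, P (ρ.rep g x) = ρ.rep g (P x)) : ∃ c : ℂ, ∀ x, P x = c • x := by
  obtain ⟨c, hc⟩ := Module.End.exists_eigenvalue P
  refine ⟨c, fun x => ?_⟩
  have hW := ρ.eq_bot_or_eq_top (Module.End.eigenspace P c) (by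
    intro g x hx
    rw [Module.End.mem_eigenspace_iff] at hx ⊢
    rw [hP, hx, map_smul])
  rcases hW with h | h
  · exact absurd h hc
  · exact Module.End.mem_eigenspace_iff.mp (h ▸ Submodule.mem_top)

/-- Schur's lemma in its unitary form: a nonzero intertwiner of irreducible unitary representations
is a multiple of a unitary one, so the representations are unitarily equivalent. -/
lemma unitaryEquivalence_of_intertwines (ρ σ : UnitaryIrrep G)
    (P : EuclideanSpace ℂ (Fin ρ.dim) →ₗ[ℂ] EuclideanSpace ℂ (Fin σ.dim)) (hP0 : P ≠ 0)
    (hP : ∀ g x, P (ρ.rep g x) = σ.rep g (P x)) :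
    (unitaryEquivalence G).r ρ σ := by
  have hker : P.ker = ⊥ := by
    refine (ρ.eq_bot_or_eq_top P.ker ?_).resolve_right fun h => hP0 (LinearMap.ker_eq_top.mp h)
    intro g x hx
    rw [LinearMap.mem_ker] at hx ⊢
    rw [hP, hx, map_zero]
  have hrange : P.range = ⊤ := by
    refine (σ.eq_bot_or_eq_top P.range ?_).resolve_left
      fun h => hP0 (LinearMap.range_eq_bot.mp h)
    rintro g _ ⟨x, rfl⟩
    exact ⟨ρ.rep g x, hP g x⟩
  -- `P† P` commutes with `ρ`, hence is a scalar `c`, and `c > 0`.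
  obtain ⟨c, hc⟩ := ρ.exists_eq_smul_of_commute (P.adjoint ∘ₗ P) (by
    intro g x
    refine ext_inner_right ℂ fun y => ?_
    have hy : P ((ρ.rep g).symm y) = (σ.rep g).symm (P y) := by
      apply (σ.rep g).injective
      rw [← hP]
      simp
    have h1 : inner ℂ (ρ.rep g ((P.adjoint ∘ₗ P) x)) y
        = inner ℂ ((P.adjoint ∘ₗ P) x) ((ρ.rep g).symm y) := by
      rw [← (ρ.rep g).inner_map_map _ ((ρ.rep g).symm y)]
      simp
    rw [h1]
    simp only [LinearMap.comp_apply, LinearMap.adjoint_inner_left]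
    rw [hP, hy, ← (σ.rep g).inner_map_map _ ((σ.rep g).symm (P y))]
    simp)
  have hnorm : ∀ x, ‖P x‖ ^ 2 = c.re * ‖x‖ ^ 2 := by
    intro x
    have h1 : inner ℂ ((P.adjoint ∘ₗ P) x) x = inner ℂ (P x) (P x) := by
      simp only [LinearMap.comp_apply, LinearMap.adjoint_inner_left]
    rw [hc, inner_smul_left, inner_self_eq_norm_sq_to_K, inner_self_eq_norm_sq_to_K] at h1
    have h2 := congrArg Complex.re h1
    simpa [← Complex.ofReal_pow] using h2.symm
  have hcpos : 0 < c.re := by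
    obtain ⟨x, hx⟩ := exists_ne (0 : EuclideanSpace ℂ (Fin ρ.dim))
    have hPx : P x ≠ 0 := fun h => hx (by
      have : x ∈ P.ker := h
      rwa [hker, Submodule.mem_bot] at this)
    have h1 := hnorm x
    have h2 : 0 < ‖P x‖ ^ 2 := by positivity
    have h3 : 0 < ‖x‖ ^ 2 := by positivity
    rw [h1] at h2
    exact (pos_iff_pos_of_mul_pos h2).mpr h3
  let U : EuclideanSpace ℂ (Fin ρ.dim) →ₗᵢ[ℂ] EuclideanSpace ℂ (Fin σ.dim) :=
    { toLinearMap := ((Real.sqrt c.re)⁻¹ : ℂ) • P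
      norm_map' := fun x => by
        have h1 : ‖P x‖ = Real.sqrt c.re * ‖x‖ := by
          rw [← Real.sqrt_sq (norm_nonneg (P x)), hnorm, Real.sqrt_mul hcpos.le,
            Real.sqrt_sq (norm_nonneg x)]
        have h2 := Real.sqrt_pos.mpr hcpos
        rw [LinearMap.smul_apply, norm_smul, h1, norm_inv, Complex.norm_real, Real.norm_of_nonneg
          h2.le, inv_mul_cancel_left₀ h2.ne'] }
  have hU : ∀ x, U x = ((Real.sqrt c.re)⁻¹ : ℂ) • P x := fun _ => rfl
  have hs : ((Real.sqrt c.re : ℝ) : ℂ) ≠ 0 := by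
    exact_mod_cast (Real.sqrt_pos.mpr hcpos).ne'
  refine ⟨LinearIsometryEquiv.ofSurjective U fun y => ?_, fun g x => ?_⟩
  · obtain ⟨x, hx⟩ := LinearMap.range_eq_top.mp hrange y
    exact ⟨((Real.sqrt c.re : ℝ) : ℂ) • x, by
      rw [map_smul, hU, hx, smul_inv_smul₀ hs]⟩
  · change U _ = σ.rep g (U x)
    rw [hU, hU, hP, map_smul]

end UnitaryIrrep

/-! ### Independence of matrix coefficients -/

/-- Burnside's theorem for several simple modules at once: if the `V i` are pairwise nonisomorphic,
any endomorphism of one factor of `∏ i, V i` is the action of a ring element that kills the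
others. -/
lemma exists_smul_eq_of_isSimpleModule {ι k R : Type*} [Fintype ι] [Field k] [IsAlgClosed k]
    [Ring R] [Algebra k R] (V : ι → Type*) [∀ i, AddCommGroup (V i)] [∀ i, Module k (V i)]
    [∀ i, Module R (V i)] [∀ i, IsScalarTower k R (V i)] [∀ i, FiniteDimensional k (V i)]
    [∀ i, IsSimpleModule R (V i)] (hV : ∀ i j, Nonempty (V i ≃ₗ[R] V j) → i = j)
    (j : ι) (Y : Module.End k (V j)) :
    ∃ r : R, (∀ x : V j, r • x = Y x) ∧ ∀ i, i ≠ j → ∀ x : V i, r • x = 0 := by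
  classical
  -- An endomorphism of the product acts on the `j`-th factor by a scalar.
  have hend : ∀ e : Module.End R (∀ i, V i), ∃ c : k, ∀ m,
      (∀ x, e (Pi.single j x) = Pi.single j (c • x)) ∧ e m j = c • m j := by
    intro e
    let E (i l : ι) : V i →ₗ[R] V l := LinearMap.proj l ∘ₗ e ∘ₗ LinearMap.single R V i
    have hE : ∀ i l x, E i l x = e (Pi.single i x) l := fun _ _ _ => rfl
    have hE0 : ∀ i l, i ≠ l → ∀ x, e (Pi.single i x) l = 0 := by
      intro i l hil x
      rcases LinearMap.bijective_or_eq_zero (E i l) with h | h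
      · exact absurd (hV i l ⟨LinearEquiv.ofBijective _ h⟩) hil
      · rw [← hE, h, LinearMap.zero_apply]
    obtain ⟨c, hc⟩ :=
      (IsSimpleModule.algebraMap_end_bijective_of_isAlgClosed k (A := R) (V := V j)).2 (E j j)
    have hc' : ∀ x, e (Pi.single j x) j = c • x := fun x => by rw [← hE, ← hc]; rfl
    refine ⟨c, fun m => ⟨fun x => ?_, ?_⟩⟩
    · funext l
      by_cases hl : l = j
      · subst hl
        rw [hc', Pi.single_eq_same]
      · rw [hE0 j l (Ne.symm hl), Pi.single_eq_of_ne hl]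
    · conv_lhs => rw [← Finset.univ_sum_single m]
      rw [map_sum, Finset.sum_apply, Finset.sum_eq_single j, hc']
      · exact fun i _ hi => hE0 i j hi _
      · exact fun h => absurd (Finset.mem_univ j) h
  let f : Module.End (Module.End R (∀ i, V i)) (∀ i, V i) :=
    { toFun := fun m => Pi.single j (Y (m j))
      map_add' := fun m m' => by rw [← Pi.single_add, ← map_add, Pi.add_apply]
      map_smul' := fun e m => by
        obtain ⟨c, hc⟩ := hend e
        rw [RingHom.id_apply, Module.End.smul_def, Module.End.smul_def, (hc m).2, (hc m).1,
          map_smul] }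
  have hf : ∀ m, f m = Pi.single j (Y (m j)) := fun _ => rfl
  let B := fun i => Module.finBasis k (V i)
  obtain ⟨r, hr⟩ := jacobson_density f (Finset.univ.image
    fun p : Σ i, Fin (Module.finrank k (V i)) => Pi.single p.1 (B p.1 p.2))
  have hr' : ∀ i l, (Pi.single j (Y ((Pi.single i (B i l) : ∀ i, V i) j)) : ∀ i, V i) i
      = r • B i l := by
    intro i l
    have h1 := congrFun (hr _ (Finset.mem_image_of_mem _ (Finset.mem_univ ⟨i, l⟩))) i
    rwa [Pi.smul_apply, hf, Pi.single_eq_same] at h1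
  refine ⟨r, fun x => ?_, fun i hi x => ?_⟩
  · refine LinearMap.congr_fun (f := Module.toModuleEnd k (S := R) (V j) r) ((B j).ext
      fun l => ?_) x
    simpa using (hr' j l).symm
  · refine LinearMap.congr_fun (f := Module.toModuleEnd k (S := R) (V i) r) (g := 0)
      ((B i).ext fun l => ?_) x
    have h := hr' i l
    rw [Pi.single_eq_of_ne hi] at h
    exact h.symm

namespace UnitaryIrrep

variable {G : Type*} [Group G]

/-- Matrix coefficients of inequivalent irreducible representations are linearly independent: the
operators `(ρ i g)_i` span `∏ i, End (V i)`, so if the functions `g ↦ tr (X i * ρ i g)` sum to zero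
then each functional `tr (X j * ·)` vanishes. -/
lemma trace_mul_eq_zero_of_sum_trace_eq_zero {ι : Type*} [Fintype ι] (ρ : ι → UnitaryIrrep G)
    (hρ : ∀ i j, (unitaryEquivalence G).r (ρ i) (ρ j) → i = j)
    (X : ∀ i, Module.End ℂ (EuclideanSpace ℂ (Fin (ρ i).dim)))
    (hX : ∀ g, ∑ i, LinearMap.trace ℂ _ (X i * (ρ i).rep.toRepresentation g) = 0)
    (j : ι) (Y : Module.End ℂ (EuclideanSpace ℂ (Fin (ρ j).dim))) :
    LinearMap.trace ℂ _ (X j * Y) = 0 := by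
  have := fun i => (ρ i).irreducible
  obtain ⟨r, hrj, hr⟩ := exists_smul_eq_of_isSimpleModule (k := ℂ) (R := MonoidAlgebra ℂ G)
    (fun i => (ρ i).rep.toRepresentation.asModule) (by
      rintro i l ⟨e⟩
      refine hρ i l ((ρ i).unitaryEquivalence_of_intertwines (ρ l)
        ((ρ l).rep.toRepresentation.asModuleEquiv.toLinearMap ∘ₗ
          (e.restrictScalars ℂ).toLinearMap ∘ₗ
          (ρ i).rep.toRepresentation.asModuleEquiv.symm.toLinearMap) (fun h => ?_) fun g x => ?_)
      · obtain ⟨x, hx⟩ := exists_ne (0 : EuclideanSpace ℂ (Fin (ρ i).dim))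
        have h1 := LinearMap.congr_fun h x
        simp [hx] at h1
      · have h1 : (ρ i).rep g x = (ρ i).rep.toRepresentation g x := rfl
        simp only [LinearMap.comp_apply, LinearEquiv.coe_coe, LinearEquiv.restrictScalars_apply]
        rw [h1, Representation.asModuleEquiv_symm_map_rho, map_smul,
          Representation.asModuleEquiv_map_smul, MonoidAlgebra.of_apply,
          Representation.asAlgebraHom_single_one]
        rfl) j Y
  have hY : (ρ j).rep.toRepresentation.asAlgebraHom r = Y := LinearMap.ext hrj
  have h0 : ∀ i, i ≠ j → (ρ i).rep.toRepresentation.asAlgebraHom r = 0 :=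
    fun i hi => LinearMap.ext (hr i hi)
  have hsum : ∀ r : MonoidAlgebra ℂ G,
      ∑ i, LinearMap.trace ℂ _ (X i * (ρ i).rep.toRepresentation.asAlgebraHom r) = 0 := by
    intro r
    induction r using MonoidAlgebra.induction_on with
    | of g => simpa using hX g
    | add a b ha hb => simp [mul_add, Finset.sum_add_distrib, ha, hb]
    | smul c a ha => simp [← Finset.mul_sum, ha]
  have h := hsum r
  rwa [Finset.sum_eq_single j (fun i _ hi => by rw [h0 i hi, mul_zero, map_zero])
    (fun h => absurd (Finset.mem_univ j) h), hY] at h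

end UnitaryIrrep

/-! ### Twisted traces of fixed representations -/

namespace UnitaryIrrep

variable {G : Type*} [Group G]

/-- The function `x ↦ tr (T ρ(x))`. If `T` intertwines `ρ` with `ρ ∘ φ`, it is constant on the
`φ`-conjugacy classes. -/
noncomputable def twistedTrace (ρ : UnitaryIrrep G)
    (T : EuclideanSpace ℂ (Fin ρ.dim) ≃ₗᵢ[ℂ] EuclideanSpace ℂ (Fin ρ.dim)) (x : G) : ℂ :=
  LinearMap.trace ℂ _ (T.toLinearEquiv.toLinearMap * ρ.rep.toRepresentation x)

lemma twistedTrace_twistedConj {φ : MulAut G} {ρ : UnitaryIrrep G}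
    {T : EuclideanSpace ℂ (Fin ρ.dim) ≃ₗᵢ[ℂ] EuclideanSpace ℂ (Fin ρ.dim)}
    (hT : ∀ g x, T (ρ.rep g x) = ρ.rep (φ g) (T x)) {x y : G} (h : (twistedConj φ).r x y) :
    ρ.twistedTrace T x = ρ.twistedTrace T y := by
  obtain ⟨g, rfl⟩ := h
  have hT' : T.toLinearEquiv.toLinearMap * ρ.rep.toRepresentation g
      = ρ.rep.toRepresentation (φ g) * T.toLinearEquiv.toLinearMap :=
    LinearMap.ext fun x => hT g x
  unfold twistedTrace
  have hinv : ρ.rep.toRepresentation (φ g⁻¹) * ρ.rep.toRepresentation (φ g) = 1 := by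
    rw [← map_mul ρ.rep.toRepresentation, ← map_mul, inv_mul_cancel, map_one, map_one]
  rw [map_mul ρ.rep.toRepresentation, map_mul ρ.rep.toRepresentation, ← mul_assoc, ← mul_assoc, hT',
    mul_assoc, mul_assoc, LinearMap.trace_mul_comm ℂ (ρ.rep.toRepresentation (φ g)),
    mul_assoc, mul_assoc, hinv, mul_one]

end UnitaryIrrep

section TwistedTraces

variable {G : Type*} [Group G]

lemma exists_twist {φ : MulAut G} (c : Function.fixedPoints (dualMap φ)) :
    ∃ ρ : UnitaryIrrep G, ∃ T : EuclideanSpace ℂ (Fin ρ.dim) ≃ₗᵢ[ℂ] EuclideanSpace ℂ (Fin ρ.dim),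
      Quotient.mk (unitaryEquivalence G) ρ = c ∧
        ∀ g x, T (ρ.rep g x) = ρ.rep (φ g) (T x) := by
  obtain ⟨c, hc⟩ := c
  induction c using Quotient.inductionOn with
  | h ρ =>
    obtain ⟨T, hT⟩ := Quotient.exact (s := unitaryEquivalence G) hc.symm
    exact ⟨ρ, T, rfl, hT⟩

/-- A representative of a `φ`-fixed point of the dual. -/
noncomputable def fixedIrrep {φ : MulAut G} (c : Function.fixedPoints (dualMap φ)) :
    UnitaryIrrep G :=
  (exists_twist c).choose

/-- A unitary operator intertwining the representation `fixedIrrep c` with its composite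
with `φ`. -/
noncomputable def fixedTwist {φ : MulAut G} (c : Function.fixedPoints (dualMap φ)) :
    EuclideanSpace ℂ (Fin (fixedIrrep c).dim) ≃ₗᵢ[ℂ] EuclideanSpace ℂ (Fin (fixedIrrep c).dim) :=
  (exists_twist c).choose_spec.choose

lemma mk_fixedIrrep {φ : MulAut G} (c : Function.fixedPoints (dualMap φ)) :
    Quotient.mk (unitaryEquivalence G) (fixedIrrep c) = c :=
  (exists_twist c).choose_spec.choose_spec.1

lemma fixedTwist_rep {φ : MulAut G} (c : Function.fixedPoints (dualMap φ)) (g : G)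
    (x : EuclideanSpace ℂ (Fin (fixedIrrep c).dim)) :
    fixedTwist c ((fixedIrrep c).rep g x) = (fixedIrrep c).rep (φ g) (fixedTwist c x) :=
  (exists_twist c).choose_spec.choose_spec.2 g x

/-- The twisted trace of a fixed point of the dual, as a function on the Reidemeister classes. -/
noncomputable def classTrace {φ : MulAut G} (c : Function.fixedPoints (dualMap φ)) :
    ReidemeisterClasses φ → ℂ :=
  Quotient.lift ((fixedIrrep c).twistedTrace (fixedTwist c))
    fun _ _ h => UnitaryIrrep.twistedTrace_twistedConj (fixedTwist_rep c) h

lemma linearIndependent_classTrace (φ : MulAut G) :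
    LinearIndependent ℂ (classTrace : Function.fixedPoints (dualMap φ) → _) := by
  rw [linearIndependent_iff_finset_linearIndependent]
  intro s
  rw [Fintype.linearIndependent_iff]
  intro a ha j
  have h := UnitaryIrrep.trace_mul_eq_zero_of_sum_trace_eq_zero (fun c : s => fixedIrrep c.1)
    (fun c d hcd => by
      apply Subtype.ext
      apply Subtype.ext
      rw [← mk_fixedIrrep c.1, ← mk_fixedIrrep d.1]
      exact Quotient.sound (s := unitaryEquivalence G) hcd)
    (fun c => a c • (fixedTwist c.1).toLinearEquiv.toLinearMap) (fun g => by
      have h1 := congrFun ha (Quotient.mk (twistedConj φ) g)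
      rw [Finset.sum_apply] at h1
      simpa [classTrace, UnitaryIrrep.twistedTrace] using h1)
    j (fixedTwist j.1).symm.toLinearEquiv.toLinearMap
  have h1 : (fixedTwist j.1).toLinearEquiv.toLinearMap *
      (fixedTwist j.1).symm.toLinearEquiv.toLinearMap = 1 :=
    LinearMap.ext fun x => (fixedTwist j.1).apply_symm_apply x
  have h2 : (Module.finrank ℂ (EuclideanSpace ℂ (Fin (fixedIrrep j.1).dim)) : ℂ) ≠ 0 :=
    Nat.cast_ne_zero.mpr Module.finrank_pos.ne'
  rw [smul_mul_assoc, h1, map_smul, LinearMap.trace_one, smul_eq_mul] at h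
  exact (mul_eq_zero.mp h).resolve_right h2

theorem fixedIrrepNumber_le_reidemeisterNumber (φ : MulAut G) :
    fixedIrrepNumber φ ≤ reidemeisterNumber φ := by
  unfold fixedIrrepNumber reidemeisterNumber
  rcases finite_or_infinite (ReidemeisterClasses φ) with h | h
  · have : Fintype (ReidemeisterClasses φ) := Fintype.ofFinite _
    have hli := linearIndependent_classTrace φ
    have := hli.finite
    have : Fintype (Function.fixedPoints (dualMap φ)) := Fintype.ofFinite _
    have h1 := hli.fintype_card_le_finrank
    rw [Module.finrank_fintype_fun_eq_card] at h1
    rw [ENat.card_eq_coe_fintype_card, ENat.card_eq_coe_fintype_card]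
    exact_mod_cast h1
  · rw [ENat.card_eq_top_of_infinite (α := ReidemeisterClasses φ)]
    exact le_top

end TwistedTraces

/-! ### Finite groups -/

section FiniteGroup

variable {K : Type*} [Group K]

/-- The restriction of a unitary representation to an invariant subspace. -/
def restrictUnitary {V : Type*} [NormedAddCommGroup V] [InnerProductSpace ℂ V]
    (σ : K →* (V ≃ₗᵢ[ℂ] V)) (W : Submodule ℂ V) (hW : ∀ g, ∀ x ∈ W, σ g x ∈ W) :
    K →* (W ≃ₗᵢ[ℂ] W) where
  toFun g :=
    { toFun := fun x => ⟨σ g x, hW g x x.2⟩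
      map_add' := fun x y => Subtype.ext (map_add (σ g) (x : V) y)
      map_smul' := fun c x => Subtype.ext (map_smul (σ g) c (x : V))
      invFun := fun x => ⟨σ g⁻¹ x, hW g⁻¹ x x.2⟩
      left_inv := fun x => Subtype.ext (by simp)
      right_inv := fun x => Subtype.ext (by simp)
      norm_map' := fun x => (σ g).norm_map x }
  map_one' := by ext x; simp
  map_mul' g h := by ext x; simp

/-- The irreducible representation on a minimal invariant subspace, in orthonormal coordinates. -/
lemma exists_unitaryIrrep_of_minimal {V : Type*} [NormedAddCommGroup V] [InnerProductSpace ℂ V]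
    [FiniteDimensional ℂ V] (σ : K →* (V ≃ₗᵢ[ℂ] V)) (W : Submodule ℂ V)
    (hW : ∀ g, ∀ x ∈ W, σ g x ∈ W) (hbot : W ≠ ⊥)
    (hmin : ∀ U ≤ W, (∀ g, ∀ x ∈ U, σ g x ∈ U) → U = ⊥ ∨ U = W) :
    ∃ (ρ : UnitaryIrrep K) (e : EuclideanSpace ℂ (Fin ρ.dim) ≃ₗᵢ[ℂ] W),
      ∀ g x, (e (ρ.rep g x) : V) = σ g (e x) := by
  let e := (stdOrthonormalBasis ℂ W).repr.symm
  let rep : UnitaryRep K (Module.finrank ℂ W) :=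
    { toFun := fun g => (e.trans (restrictUnitary σ W hW g)).trans e.symm
      map_one' := by ext x; simp
      map_mul' := fun g h => by ext x; simp }
  have hrep : ∀ g x, (e (rep g x) : V) = σ g (e x) := fun g x =>
    congrArg Subtype.val (e.apply_symm_apply _)
  let f : EuclideanSpace ℂ (Fin (Module.finrank ℂ W)) →ₗ[ℂ] V :=
    W.subtype ∘ₗ e.toLinearEquiv.toLinearMap
  have hf : Function.Injective f := W.subtype_injective.comp e.injective
  have hfr : ∀ g x, f (rep g x) = σ g (f x) := hrep
  have hftop : Submodule.map f ⊤ = W := by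
    rw [Submodule.map_top, LinearMap.range_comp, LinearEquiv.range, Submodule.map_top,
      Submodule.range_subtype]
  refine ⟨⟨_, rep, ?_⟩, e, hrep⟩
  have : Nontrivial (Subrepresentation rep.toRepresentation) := by
    refine ⟨⊥, ⊤, fun h => hbot ?_⟩
    have h1 : (⊥ : Submodule ℂ _) = ⊤ := congrArg Subrepresentation.toSubmodule h
    rw [← hftop, ← h1, Submodule.map_bot]
  refine ⟨fun S => ?_⟩
  have hS := hmin (S.toSubmodule.map f) (by
      rintro _ ⟨x, -, rfl⟩
      exact (e x).2) (by
      rintro g _ ⟨x, hx, rfl⟩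
      exact ⟨rep g x, S.apply_mem_toSubmodule g hx, hfr g x⟩)
  rcases hS with h | h
  · left
    apply Subrepresentation.toSubmodule_injective
    exact (Submodule.map_injective_of_injective hf) (h.trans (Submodule.map_bot f).symm)
  · right
    apply Subrepresentation.toSubmodule_injective
    exact (Submodule.map_injective_of_injective hf) (h.trans hftop.symm)

/-- An element of the group algebra that acts as zero in every irreducible representation acts as
zero in every finite-dimensional unitary representation, by complete reducibility. -/
lemma sum_smul_apply_eq_zero [Fintype K] {f : K → ℂ}
    (hf : ∀ (ρ : UnitaryIrrep K) (x), ∑ g, f g • ρ.rep g x = 0)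
    {V : Type*} [NormedAddCommGroup V] [InnerProductSpace ℂ V]
    [FiniteDimensional ℂ V] (σ : K →* (V ≃ₗᵢ[ℂ] V)) (W : Submodule ℂ V)
    (hW : ∀ g, ∀ x ∈ W, σ g x ∈ W) : ∀ x ∈ W, ∑ g, f g • σ g x = 0 := by
  induction hn : Module.finrank ℂ W using Nat.strong_induction_on generalizing W with
  | _ n ih =>
  subst hn
  intro x hx
  by_cases hbot : W = ⊥
  · rw [hbot, Submodule.mem_bot] at hx
    simp [hx]
  by_cases hmin : ∀ U ≤ W, (∀ g, ∀ x ∈ U, σ g x ∈ U) → U = ⊥ ∨ U = W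
  · obtain ⟨ρ, e, he⟩ := exists_unitaryIrrep_of_minimal σ W hW hbot hmin
    have h := congrArg (fun y => (e y : V)) (hf ρ (e.symm ⟨x, hx⟩))
    simpa [map_sum, he] using h
  · push Not at hmin
    obtain ⟨U, hUW, hU, hU0, hU1⟩ := hmin
    have hU' : ∀ g, ∀ x ∈ Uᗮ ⊓ W, σ g x ∈ Uᗮ ⊓ W := by
      rintro g x ⟨hx, hxW⟩
      refine ⟨?_, hW g x hxW⟩
      rw [SetLike.mem_coe, Submodule.mem_orthogonal] at hx ⊢
      intro u hu
      rw [← hx _ (hU g⁻¹ u hu), ← (σ g).inner_map_map (σ g⁻¹ u)]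
      simp
    have hlt : Uᗮ ⊓ W < W := by
      refine lt_of_le_of_ne inf_le_right fun h => hU0 ?_
      have h1 : U ≤ Uᗮ := hUW.trans (inf_eq_right.mp h)
      rw [Submodule.eq_bot_iff]
      intro u hu
      exact inner_self_eq_zero.mp (Submodule.mem_orthogonal U u |>.mp (h1 hu) u hu)
    obtain ⟨y, hy, z, hz, rfl⟩ := U.exists_add_mem_mem_orthogonal x
    have hzW : z ∈ W := by simpa using W.sub_mem hx (hUW hy)
    have h1 := ih _ (Submodule.finrank_lt_finrank_of_lt (lt_of_le_of_ne hUW hU1)) U hU rfl y hy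
    have h2 := ih _ (Submodule.finrank_lt_finrank_of_lt hlt) _ hU' rfl z ⟨hz, hzW⟩
    simp [smul_add, Finset.sum_add_distrib, h1, h2]

/-- The group algebra of a finite group acts faithfully on the sum of all irreducible unitary
representations. -/
lemma eq_zero_of_forall_unitaryIrrep [Fintype K] {f : K → ℂ}
    (hf : ∀ (ρ : UnitaryIrrep K) (x), ∑ g, f g • ρ.rep g x = 0) : f = 0 := by
  classical
  let σ : K →* (EuclideanSpace ℂ K ≃ₗᵢ[ℂ] EuclideanSpace ℂ K) :=
    { toFun := fun g => LinearIsometryEquiv.piLpCongrLeft 2 ℂ ℂ (Equiv.mulLeft g)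
      map_one' := by ext x i; simp [LinearIsometryEquiv.piLpCongrLeft_apply, Equiv.Perm.one_def]
      map_mul' := fun g h => by
        ext x i
        simp [LinearIsometryEquiv.piLpCongrLeft_apply, Equiv.Perm.mul_def] }
  funext k
  have h := sum_smul_apply_eq_zero hf σ ⊤ (fun _ _ _ => Submodule.mem_top)
    (EuclideanSpace.single 1 1) Submodule.mem_top
  have h1 : ∀ g, σ g (EuclideanSpace.single 1 1) = EuclideanSpace.single g 1 := fun g => by
    simp [σ]
  have h2 := congrArg (fun v : EuclideanSpace ℂ K => v k) h
  simpa [h1, Pi.single_apply] using h2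

/-- On a finite group a twisted class function `f` orthogonal to all twisted traces vanishes:
`ρ(f) = ∑ f(x) ρ(x)` intertwines `ρ ∘ ψ` with `ρ`, so by Schur's lemma it is zero unless `ρ` is
fixed, and it is a scalar multiple of the inverse twist if `ρ` is fixed. -/
lemma eq_zero_of_sum_mul_classTrace [Fintype K] {ψ : MulAut K} {f : ReidemeisterClasses ψ → ℂ}
    (hf : ∀ c : Function.fixedPoints (dualMap ψ),
      ∑ x, f (Quotient.mk _ x) * classTrace c (Quotient.mk _ x) = 0) : f = 0 := by
  have key : (fun x => f (Quotient.mk (twistedConj ψ) x)) = 0 := by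
    apply eq_zero_of_forall_unitaryIrrep
    intro ρ v
    let P (ρ : UnitaryIrrep K) : EuclideanSpace ℂ (Fin ρ.dim) →ₗ[ℂ] EuclideanSpace ℂ (Fin ρ.dim) :=
      ∑ x, f (Quotient.mk (twistedConj ψ) x) • ρ.rep.toRepresentation x
    have hP : ∀ ρ v, P ρ v = ∑ x, f (Quotient.mk (twistedConj ψ) x) • ρ.rep x v := fun ρ v => by
      simp only [P, LinearMap.sum_apply, LinearMap.smul_apply]
      rfl
    have hPint : ∀ (ρ : UnitaryIrrep K) g v, P ρ (ρ.rep (ψ g) v) = ρ.rep g (P ρ v) := by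
      intro ρ g v
      rw [hP, hP, map_sum]
      refine Fintype.sum_equiv ((Equiv.mulRight (ψ g)).trans (Equiv.mulLeft g⁻¹)) _ _ fun x => ?_
      rw [map_smul]
      congr 1
      · congr 1
        refine Quotient.sound (s := twistedConj ψ) ⟨g⁻¹, ?_⟩
        simp [mul_assoc]
      · change (ρ.rep x * ρ.rep (ψ g)) v = (ρ.rep g * ρ.rep (g⁻¹ * (x * ψ g))) v
        rw [← map_mul, ← map_mul]
        simp
    rw [← hP]
    suffices P ρ = 0 by rw [this, LinearMap.zero_apply]
    by_contra hne
    have hfix : dualMap ψ (Quotient.mk _ ρ) = Quotient.mk _ ρ :=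
      Quotient.sound (s := unitaryEquivalence K)
        ((ρ.comp ψ).unitaryEquivalence_of_intertwines ρ (P ρ) hne (hPint ρ))
    obtain ⟨c, hc⟩ : ∃ c : Function.fixedPoints (dualMap ψ), c.1 = Quotient.mk _ ρ :=
      ⟨⟨_, hfix⟩, rfl⟩
    rw [← mk_fixedIrrep c] at hc
    obtain ⟨U, hU⟩ := Quotient.exact (s := unitaryEquivalence K) hc
    obtain ⟨a, ha⟩ := (fixedIrrep c).exists_eq_smul_of_commute
      ((fixedTwist c).toLinearEquiv.toLinearMap ∘ₗ P (fixedIrrep c)) (by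
        intro g x
        obtain ⟨g, rfl⟩ := ψ.surjective g
        change fixedTwist c (P _ _) = (fixedIrrep c).rep _ (fixedTwist c (P _ x))
        rw [hPint, fixedTwist_rep])
    have hcomp : (fixedTwist c).toLinearEquiv.toLinearMap ∘ₗ P (fixedIrrep c) = a • 1 :=
      LinearMap.ext ha
    have htr : LinearMap.trace ℂ _
        ((fixedTwist c).toLinearEquiv.toLinearMap ∘ₗ P (fixedIrrep c)) = 0 := by
      rw [← hf c, ← Module.End.mul_eq_comp, Finset.mul_sum, map_sum]
      refine Finset.sum_congr rfl fun x _ => ?_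
      rw [mul_smul_comm, map_smul]
      rfl
    have h2 : (Module.finrank ℂ (EuclideanSpace ℂ (Fin (fixedIrrep c).dim)) : ℂ) ≠ 0 :=
      Nat.cast_ne_zero.mpr Module.finrank_pos.ne'
    rw [hcomp, map_smul, LinearMap.trace_one, smul_eq_mul] at htr
    have ha0 := (mul_eq_zero.mp htr).resolve_right h2
    apply hne
    ext1 v
    obtain ⟨w, rfl⟩ := U.surjective v
    have h3 : P (fixedIrrep c) w = 0 := by
      have h4 : fixedTwist c (P (fixedIrrep c) w) = a • w := ha w
      rw [ha0, zero_smul] at h4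
      exact (fixedTwist c).map_eq_zero_iff.mp h4
    have h5 := congrArg U h3
    rw [hP, map_sum] at h5
    simpa [hP, hU] using h5
  funext c
  induction c using Quotient.inductionOn with
  | h x => exact congrFun key x

theorem reidemeisterNumber_le_fixedIrrepNumber [Finite K] (ψ : MulAut K) :
    reidemeisterNumber ψ ≤ fixedIrrepNumber ψ := by
  have : Fintype K := Fintype.ofFinite K
  have : Fintype (ReidemeisterClasses ψ) := Fintype.ofFinite _
  have := (linearIndependent_classTrace ψ).finite
  have : Fintype (Function.fixedPoints (dualMap ψ)) := Fintype.ofFinite _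
  let L : (ReidemeisterClasses ψ → ℂ) →ₗ[ℂ] (Function.fixedPoints (dualMap ψ) → ℂ) :=
    { toFun := fun f c => ∑ x : K, f (Quotient.mk _ x) * classTrace c (Quotient.mk _ x)
      map_add' := fun f f' => by
        funext c
        simp [add_mul, Finset.sum_add_distrib]
      map_smul' := fun a f => by
        funext c
        simp [Finset.mul_sum, mul_assoc] }
  have hL : Function.Injective L := by
    rw [← LinearMap.ker_eq_bot, LinearMap.ker_eq_bot']
    exact fun f hf => eq_zero_of_sum_mul_classTrace (congrFun hf)
  have h := LinearMap.finrank_le_finrank_of_injective hL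
  rw [Module.finrank_fintype_fun_eq_card, Module.finrank_fintype_fun_eq_card] at h
  unfold fixedIrrepNumber reidemeisterNumber
  rw [ENat.card_eq_coe_fintype_card, ENat.card_eq_coe_fintype_card]
  exact_mod_cast h

end FiniteGroup

/-! ### Passage from a finite quotient -/

section Inflation

variable {G K : Type*} [Group G] [Group K]

/-- The inflation of an irreducible representation along an epimorphism. -/
noncomputable def UnitaryIrrep.inflate (F : G →* K) (hF : Function.Surjective F)
    (ρ : UnitaryIrrep K) : UnitaryIrrep G where
  dim := ρ.dim
  rep := ρ.rep.comp F
  irreducible := by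
    have h := ρ.irreducible
    let e : Subrepresentation ρ.rep.toRepresentation ≃o
        Subrepresentation (UnitaryRep.toRepresentation (ρ.rep.comp F)) :=
      { toFun := fun W => ⟨W.toSubmodule, fun g _ hv => W.apply_mem_toSubmodule (F g) hv⟩
        invFun := fun W => ⟨W.toSubmodule, fun k v hv => by
          obtain ⟨g, rfl⟩ := hF k
          exact W.apply_mem_toSubmodule g hv⟩
        left_inv := fun _ => rfl
        right_inv := fun _ => rfl
        map_rel_iff' := Iff.rfl }
    exact (OrderIso.isSimpleOrder_iff e).mp h

lemma fixedIrrepNumber_le_of_surjective {φ : MulAut G} {ψ : MulAut K} (F : G →* K)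
    (hF : Function.Surjective F) (hφ : ∀ g, F (φ g) = ψ (F g)) :
    fixedIrrepNumber ψ ≤ fixedIrrepNumber φ := by
  let I : FinUnitaryDual K → FinUnitaryDual G :=
    Quotient.map (sa := unitaryEquivalence K) (sb := unitaryEquivalence G)
      (UnitaryIrrep.inflate F hF) (by
        rintro ρ σ ⟨T, hT⟩
        exact ⟨T, fun g x => hT (F g) x⟩)
  have hI : Function.Injective I := by
    intro c d
    induction c using Quotient.inductionOn with | h ρ =>
    induction d using Quotient.inductionOn with | h σ =>
    intro h
    obtain ⟨T, hT⟩ := Quotient.exact (s := unitaryEquivalence G) h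
    refine Quotient.sound (s := unitaryEquivalence K) ⟨T, fun k x => ?_⟩
    obtain ⟨g, rfl⟩ := hF k
    exact hT g x
  have hcomm : ∀ c, dualMap φ (I c) = I (dualMap ψ c) := by
    intro c
    induction c using Quotient.inductionOn with | h ρ =>
    refine Quotient.sound (s := unitaryEquivalence G) ⟨LinearIsometryEquiv.refl ℂ _, fun g x => ?_⟩
    change ρ.rep (F (φ g)) x = ρ.rep (ψ (F g)) x
    rw [hφ]
  refine ENat.card_le_card_of_injective
    (f := fun c : Function.fixedPoints (dualMap ψ) =>
      (⟨I c, (hcomm c).trans (congrArg I c.2)⟩ : Function.fixedPoints (dualMap φ))) ?_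
  intro c d h
  exact Subtype.ext (hI (congrArg Subtype.val h))

lemma reidemeisterNumber_le_of_preimage {φ : MulAut G} {ψ : MulAut K} (F : G →* K)
    (hF : Function.Surjective F) (hφ : ∀ g, F (φ g) = ψ (F g))
    (hcl : ∀ c : ReidemeisterClasses φ, ∃ S : Set K,
      {x : G | Quotient.mk (twistedConj φ) x = c} = F ⁻¹' S) :
    reidemeisterNumber φ ≤ reidemeisterNumber ψ := by
  refine ENat.card_le_card_of_injective
    (f := Quotient.map (sa := twistedConj φ) (sb := twistedConj ψ) F ?_) ?_
  · rintro x _ ⟨g, rfl⟩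
    exact ⟨F g, by rw [map_mul, map_mul, hφ, map_inv]⟩
  · intro c d
    induction c using Quotient.inductionOn with | h x =>
    induction d using Quotient.inductionOn with | h y =>
    intro h
    obtain ⟨k, hk⟩ := Quotient.exact (s := twistedConj ψ) h
    obtain ⟨g, rfl⟩ := hF k
    obtain ⟨S, hS⟩ := hcl (Quotient.mk _ x)
    have h1 : g * x * φ g⁻¹ ∈ F ⁻¹' S := by
      rw [← hS]
      exact (Quotient.sound (s := twistedConj φ) ⟨g, rfl⟩ : _).symm
    have h2 : F (g * x * φ g⁻¹) = F y := by rw [map_mul, map_mul, hφ, map_inv, hk]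
    have h3 : y ∈ F ⁻¹' S := by
      rw [Set.mem_preimage, ← h2]
      exact h1
    rw [← hS] at h3
    exact h3.symm

end Inflation

theorem IsRPGroup.reidemeisterNumber_eq {G : Type*} [Group G] (hG : IsRPGroup G) (φ : MulAut G)
    (hφ : reidemeisterNumber φ ≠ ⊤) : reidemeisterNumber φ = fixedIrrepNumber φ := by
  obtain ⟨K, _, _, ψ, F, hF, hFφ, hcl⟩ := hG φ hφ
  exact le_antisymm
    ((reidemeisterNumber_le_of_preimage F hF hFφ hcl).trans
      ((reidemeisterNumber_le_fixedIrrepNumber ψ).trans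
        (fixedIrrepNumber_le_of_surjective F hF hFφ)))
    (fixedIrrepNumber_le_reidemeisterNumber φ)

/-- A finite-index normal subgroup `N` with `φ(N) ≤ N` whose right translations preserve the
`φ`-conjugacy classes provides the finite quotient required by the RP property. -/
lemma exists_finite_quotient {G : Type*} [Group G] (φ : MulAut G) (N : Subgroup G) [N.Normal]
    [N.FiniteIndex] (hN : N ≤ N.comap φ.toMonoidHom)
    (hcl : ∀ g, ∀ n ∈ N, (twistedConj φ).r g (g * n)) :
    ∃ (K : Type) (_ : Group K) (_ : Finite K) (ψ : MulAut K) (F : G →* K),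
      Function.Surjective F ∧ (∀ g, F (φ g) = ψ (F g)) ∧
        ∀ c : ReidemeisterClasses φ, ∃ S : Set K,
          {x : G | Quotient.mk (twistedConj φ) x = c} = F ⁻¹' S := by
  obtain ⟨K, _, _, ⟨e⟩⟩ := Finite.exists_type_univ_nonempty_mulEquiv.{_, 0} (G ⧸ N)
  let F : G →* K := e.toMonoidHom.comp (QuotientGroup.mk' N)
  have hF : Function.Surjective F := e.surjective.comp (QuotientGroup.mk'_surjective N)
  let p : K →* K := (e.toMonoidHom.comp (QuotientGroup.map N N φ.toMonoidHom hN)).comp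
    e.symm.toMonoidHom
  have hp : ∀ g, F (φ g) = p (F g) := fun g => by
    simp [F, p]
  have hsurj : Function.Surjective p := by
    intro k
    obtain ⟨g, rfl⟩ := hF k
    obtain ⟨g, rfl⟩ := φ.surjective g
    exact ⟨F g, (hp g).symm⟩
  refine ⟨K, inferInstance, inferInstance,
    MulEquiv.ofBijective p (Finite.surjective_iff_bijective.mp hsurj), F, hF, hp, fun c => ?_⟩
  refine ⟨F '' {x : G | Quotient.mk (twistedConj φ) x = c}, ?_⟩
  refine (Set.subset_preimage_image _ _).antisymm ?_
  rintro y ⟨x, hx, hxy⟩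
  have h1 : x⁻¹ * y ∈ N := QuotientGroup.eq.mp (e.injective hxy)
  have h2 := hcl x _ h1
  rw [mul_inv_cancel_left] at h2
  exact (Quotient.sound (s := twistedConj φ) h2).symm.trans hx

/-! ### Invariant subgroups of finite index -/

/-- A finite-index subgroup `H` of a finitely generated `ℤ[s]`-module that is stable under `s`
contains a finite-index subgroup stable under everything that commutes with `s`. Here finite
generation means that the smallest `s`-stable subgroup containing the finitely generated group `L`
is everything. -/
lemma exists_finite_quotient_le_of_commute {Γ : Type*} [AddCommGroup Γ] (s : Module.End ℤ Γ)
    (L : Submodule ℤ Γ) (hL : L.FG) (hgen : ∀ Q : Submodule ℤ Γ, L ≤ Q → Q ≤ Q.comap s → Q = ⊤)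
    (H : Submodule ℤ Γ) [Finite (Γ ⧸ H)] (hH : H ≤ H.comap s) :
    ∃ M ≤ H, Finite (Γ ⧸ M) ∧ ∀ u : Module.End ℤ Γ, Commute u s → M ≤ M.comap u := by
  have : Finite (Module.End ℤ (Γ ⧸ H)) := DFunLike.finite _
  -- Some monic polynomial `s ^ a - s ^ b` maps `Γ` into `H`.
  obtain ⟨a, b, hba, hab⟩ : ∃ a b : ℕ, b < a ∧ (H.mapQ H s hH) ^ a = (H.mapQ H s hH) ^ b := by
    obtain ⟨a, b, hne, hab⟩ := Finite.exists_ne_map_eq_of_infinite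
      fun k : ℕ => (H.mapQ H s hH) ^ k
    rcases lt_or_gt_of_ne hne with h | h
    · exact ⟨b, a, h, hab.symm⟩
    · exact ⟨a, b, h, hab⟩
  have hpow : ∀ (k : ℕ) x, H.mkQ ((s ^ k) x) = ((H.mapQ H s hH) ^ k) (H.mkQ x) := by
    intro k
    induction k with
    | zero => intro x; rfl
    | succ k ih =>
      intro x
      rw [pow_succ', pow_succ', Module.End.mul_apply, Module.End.mul_apply, ← ih]
      rfl
  let n : ℕ := Nat.card (Γ ⧸ H)
  have hn : n ≠ 0 := Nat.card_pos.ne'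
  let p : Module.End ℤ Γ := s ^ a - s ^ b
  let M : Submodule ℤ Γ := LinearMap.range (n : Module.End ℤ Γ) ⊔ LinearMap.range p
  refine ⟨M, ?_, ?_, ?_⟩
  · refine sup_le ?_ ?_
    · rintro _ ⟨x, rfl⟩
      rw [← Submodule.Quotient.mk_eq_zero, Module.End.natCast_apply]
      exact (map_nsmul H.mkQ n x).trans (card_nsmul_eq_zero' (x := H.mkQ x))
    · rintro _ ⟨x, rfl⟩
      rw [← Submodule.Quotient.mk_eq_zero]
      change H.mkQ ((s ^ a) x - (s ^ b) x) = 0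
      rw [map_sub, hpow, hpow, hab, sub_self]
  · let Q : Submodule ℤ Γ := ⨆ i ∈ Finset.range a, L.map (s ^ i)
    have hQ : Q.FG := Submodule.fg_biSup _ _ fun i _ => hL.map _
    have hmem : ∀ i < a, ∀ x ∈ L, (s ^ i) x ∈ Q := fun i hi x hx =>
      (le_biSup (fun i => L.map (s ^ i)) (Finset.mem_range.mpr hi))
        (Submodule.mem_map_of_mem hx)
    have htop : M ⊔ Q = ⊤ := by
      apply hgen
      · intro x hx
        exact Submodule.mem_sup_right (hmem 0 (by omega) x hx)
      · refine sup_le (sup_le ?_ ?_) (iSup₂_le fun i hi => ?_)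
        · rintro _ ⟨x, rfl⟩
          refine Submodule.mem_sup_left (Submodule.mem_sup_left ⟨s x, ?_⟩)
          simp [Module.End.natCast_apply]
        · rintro _ ⟨x, rfl⟩
          refine Submodule.mem_sup_left (Submodule.mem_sup_right ⟨s x, ?_⟩)
          exact LinearMap.congr_fun
            (((Commute.refl s).pow_left a).sub_left ((Commute.refl s).pow_left b)).eq x
        · rintro _ ⟨x, hx, rfl⟩
          rw [Submodule.mem_comap, ← Module.End.mul_apply, ← pow_succ']
          rcases Nat.lt_or_ge (i + 1) a with h | h
          · exact Submodule.mem_sup_right (hmem _ h x hx)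
          · have hi' : i + 1 = a := le_antisymm (Finset.mem_range.mp hi) h
            have h1 : (s ^ (i + 1)) x = p x + (s ^ b) x := by
              rw [hi']
              exact (sub_add_cancel _ _).symm
            rw [h1]
            exact add_mem (Submodule.mem_sup_left (Submodule.mem_sup_right ⟨x, rfl⟩))
              (Submodule.mem_sup_right (hmem b hba x hx))
    have : Module.Finite ℤ (Γ ⧸ M) := by
      refine ⟨?_⟩
      have h1 : (⊤ : Submodule ℤ (Γ ⧸ M)) = Q.map M.mkQ := by
        rw [← Submodule.range_mkQ M, ← Submodule.map_top, ← htop, Submodule.map_sup,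
          Submodule.mkQ_map_self, bot_sup_eq]
      rw [h1]
      exact hQ.map _
    refine Module.finite_of_fg_torsion _ fun x => ?_
    obtain ⟨x, rfl⟩ := M.mkQ_surjective x
    refine ⟨⟨(n : ℤ), mem_nonZeroDivisors_of_ne_zero (by exact_mod_cast hn)⟩, ?_⟩
    change (n : ℤ) • M.mkQ x = 0
    rw [← map_smul]
    refine (Submodule.Quotient.mk_eq_zero M).mpr (Submodule.mem_sup_left ⟨x, ?_⟩)
    simp [Module.End.natCast_apply]
  · intro u hu
    refine sup_le ?_ ?_
    · rintro _ ⟨x, rfl⟩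
      refine Submodule.mem_sup_left ⟨u x, ?_⟩
      simp [Module.End.natCast_apply]
    · rintro _ ⟨x, rfl⟩
      exact Submodule.mem_sup_right ⟨u x,
        LinearMap.congr_fun ((hu.pow_right a).sub_right (hu.pow_right b)).eq.symm x⟩

/-! ### Semidirect products of an abelian group with `ℤ` -/

namespace IntSemidirect

open Multiplicative

variable {Γ : Type*} [AddCommGroup Γ] {α : Multiplicative ℤ →* MulAut (Multiplicative Γ)}

/-- The additive form of the action of `k : ℤ` on `Γ`. -/
def act (α : Multiplicative ℤ →* MulAut (Multiplicative Γ)) (k : ℤ) : Module.End ℤ Γ :=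
  AddMonoidHom.toIntLinearMap
    { toFun := fun x => toAdd (α (ofAdd k) (ofAdd x))
      map_zero' := congrArg toAdd (map_one (α (ofAdd k)))
      map_add' := fun x y => congrArg toAdd (map_mul (α (ofAdd k)) (ofAdd x) (ofAdd y)) }

lemma act_add (k l : ℤ) : act α (k + l) = act α k * act α l :=
  LinearMap.ext fun x => congrArg toAdd
    (DFunLike.congr_fun (map_mul α (ofAdd k) (ofAdd l)) (ofAdd x))

lemma act_zero : act α 0 = 1 :=
  LinearMap.ext fun x => congrArg toAdd (DFunLike.congr_fun (map_one α) (ofAdd x))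

lemma act_add_apply (k l : ℤ) (x : Γ) : act α (k + l) x = act α k (act α l x) := by
  rw [act_add, Module.End.mul_apply]

lemma act_zero_apply (x : Γ) : act α 0 x = x := by rw [act_zero, Module.End.one_apply]

lemma act_neg_act (k : ℤ) (x : Γ) : act α (-k) (act α k x) = x := by
  rw [← act_add_apply, neg_add_cancel, act_zero_apply]

lemma act_act_neg (k : ℤ) (x : Γ) : act α k (act α (-k) x) = x := by
  rw [← act_add_apply, add_neg_cancel, act_zero_apply]

lemma commute_act (k l : ℤ) : Commute (act α k) (act α l) := by
  rw [Commute, SemiconjBy, ← act_add, add_comm, act_add]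

variable (α) in
/-- The element of `Γ ⋊ ℤ` with components `x` and `k`, written additively. -/
def el (x : Γ) (k : ℤ) : Multiplicative Γ ⋊[α] Multiplicative ℤ := ⟨ofAdd x, ofAdd k⟩

lemma exists_eq_el (g : Multiplicative Γ ⋊[α] Multiplicative ℤ) : ∃ x k, g = el α x k :=
  ⟨toAdd g.left, toAdd g.right, rfl⟩

lemma el_inj {x y : Γ} {k l : ℤ} : el α x k = el α y l ↔ x = y ∧ k = l := by
  constructor
  · intro h
    exact ⟨congrArg (fun g => toAdd (SemidirectProduct.left g)) h,
      congrArg (fun g => toAdd (SemidirectProduct.right g)) h⟩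
  · rintro ⟨rfl, rfl⟩
    rfl

lemma el_mul (x y : Γ) (k l : ℤ) : el α x k * el α y l = el α (x + act α k y) (k + l) := rfl

lemma el_zero : el α (0 : Γ) 0 = 1 := rfl

lemma el_inv (x : Γ) (k : ℤ) : (el α x k)⁻¹ = el α (-act α (-k) x) (-k) := by
  rw [inv_eq_iff_mul_eq_one, el_mul, ← el_zero, el_inj]
  simp [act_act_neg]

lemma el_pow (k : ℤ) (n : ℕ) : (el α (0 : Γ) k) ^ n = el α 0 (n * k) := by
  induction n with
  | zero => simp [el_zero]
  | succ n ih => rw [pow_succ, ih, el_mul, map_zero, add_zero]; push_cast; ring_nf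

/-- The subgroup `{(x, k) : x ∈ M, m ∣ k}` of `Γ ⋊ ℤ`. -/
def congruenceSubgroup (M : Submodule ℤ Γ) (hM : ∀ k, M ≤ M.comap (act α k)) (m : ℤ) :
    Subgroup (Multiplicative Γ ⋊[α] Multiplicative ℤ) where
  carrier := {g | toAdd g.left ∈ M ∧ m ∣ toAdd g.right}
  mul_mem' := fun {g h} hg hh => ⟨M.add_mem hg.1 (hM _ hh.1), dvd_add hg.2 hh.2⟩
  one_mem' := ⟨M.zero_mem, dvd_zero m⟩
  inv_mem' := fun {g} hg => by
    obtain ⟨x, k, rfl⟩ := exists_eq_el g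
    rw [el_inv]
    exact ⟨M.neg_mem (hM _ hg.1), (dvd_neg).mpr hg.2⟩

lemma el_mem_congruenceSubgroup {M : Submodule ℤ Γ} {hM : ∀ k, M ≤ M.comap (act α k)} {m : ℤ}
    {x : Γ} {k : ℤ} : el α x k ∈ congruenceSubgroup M hM m ↔ x ∈ M ∧ m ∣ k := Iff.rfl

lemma congruenceSubgroup_normal {M : Submodule ℤ Γ} {hM : ∀ k, M ≤ M.comap (act α k)} {m : ℤ}
    (hm : ∀ k, m ∣ k → ∀ x, act α k x - x ∈ M) : (congruenceSubgroup M hM m).Normal := by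
  refine ⟨fun n hn g => ?_⟩
  obtain ⟨x, k, rfl⟩ := exists_eq_el n
  obtain ⟨h, l, rfl⟩ := exists_eq_el g
  rw [el_mem_congruenceSubgroup] at hn
  rw [el_inv, el_mul, el_mul, el_mem_congruenceSubgroup]
  constructor
  · have h1 : h + act α l x + act α (l + k) (-act α (-l) h) = act α l x - (act α k h - h) := by
      rw [add_comm l k, act_add_apply, map_neg, act_act_neg, map_neg]
      abel
    rw [h1]
    exact M.sub_mem (hM _ hn.1) (hm k hn.2 h)
  · simpa using hn.2

lemma congruenceSubgroup_finiteIndex {M : Submodule ℤ Γ} {hM : ∀ k, M ≤ M.comap (act α k)}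
    {m : ℤ} (hm : m ≠ 0) [Finite (Γ ⧸ M)] : (congruenceSubgroup M hM m).FiniteIndex := by
  have : NeZero m.natAbs := ⟨Int.natAbs_ne_zero.mpr hm⟩
  let f : (Multiplicative Γ ⋊[α] Multiplicative ℤ) ⧸ congruenceSubgroup M hM m →
      (Γ ⧸ M) × ZMod m.natAbs :=
    fun q => (M.mkQ (toAdd q.out.left), ((toAdd q.out.right : ℤ) : ZMod m.natAbs))
  have hf : Function.Injective f := by
    intro q r h
    obtain ⟨x, k, hq⟩ := exists_eq_el q.out
    obtain ⟨y, l, hr⟩ := exists_eq_el r.out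
    have h1 : M.mkQ x = M.mkQ y := by simpa [f, hq, hr, el] using congrArg Prod.fst h
    have h2 : ((k : ℤ) : ZMod m.natAbs) = (l : ℤ) := by
      simpa [f, hq, hr, el] using congrArg Prod.snd h
    rw [← q.out_eq, ← r.out_eq, hq, hr]
    refine QuotientGroup.eq.mpr ?_
    rw [el_inv, el_mul, el_mem_congruenceSubgroup, neg_add_eq_sub, ← map_sub]
    refine ⟨hM _ ((Submodule.Quotient.eq M).mp h1.symm), ?_⟩
    rw [ZMod.intCast_eq_intCast_iff_dvd_sub, Int.natCast_natAbs, abs_dvd] at h2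
    rwa [neg_add_eq_sub]
  have := Finite.of_injective f hf
  exact Subgroup.finiteIndex_of_finite_quotient

/-! ### Automorphisms with finite Reidemeister number -/

/-- If no nonzero integer has a nonzero fixed vector in `Γ`, every automorphism of `Γ ⋊ ℤ` maps `Γ`
into itself: otherwise the abelian normal subgroup `φ(Γ)` contains some `(z, n)` with `n ≠ 0`, and
commuting with its own commutators forces `(1 - act α n) ^ 2` to kill `Γ`. -/
lemma right_apply_el_zero (hfree : ∀ n : ℤ, n ≠ 0 → ∀ x : Γ, act α n x = x → x = 0)
    (φ : MulAut (Multiplicative Γ ⋊[α] Multiplicative ℤ)) (x : Γ) :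
    ∃ y, φ (el α x 0) = el α y 0 := by
  obtain ⟨z, n, hz⟩ := exists_eq_el (φ (el α x 0))
  rcases eq_or_ne n 0 with rfl | hn
  · exact ⟨z, hz⟩
  exfalso
  have hΓ : ∀ y : Γ, y = 0 := by
    intro y
    obtain ⟨v, hv⟩ := φ.surjective (el α y 0)
    obtain ⟨h, l, rfl⟩ := exists_eq_el v
    have h1 : el α h l * el α x 0 * (el α h l)⁻¹ * (el α x 0)⁻¹ = el α (act α l x - x) 0 := by
      rw [el_inv, el_inv, el_mul, el_mul, el_mul, el_inj]
      simp [act_act_neg, act_zero_apply]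
      abel
    have h2 : el α (act α l x - x) 0 * el α x 0 = el α x 0 * el α (act α l x - x) 0 := by
      rw [el_mul, el_mul, act_zero_apply, act_zero_apply, add_comm]
    have h3 := congrArg φ h1
    rw [map_mul, map_mul, map_mul, map_inv, map_inv, hv, hz, el_inv, el_inv, el_mul, el_mul,
      el_mul] at h3
    have h4 := congrArg φ h2
    rw [map_mul, map_mul, ← h3, hz, el_mul, el_mul, el_inj] at h4
    have h5 := h4.1
    simp only [zero_add, add_zero, neg_zero, map_neg, act_zero_apply, act_act_neg, add_neg_cancel]
      at h5
    have h6 : y - act α n y = 0 := by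
      apply hfree n hn
      simp only [map_add, map_neg, map_sub] at h5 ⊢
      rw [← sub_eq_zero] at h5
      rw [← sub_eq_zero, ← neg_eq_zero, ← h5]
      abel
    exact hfree n hn y (sub_eq_zero.mp h6).symm
  have h1 : φ (el α x 0) = 1 := by rw [hΓ x, el_zero, map_one]
  rw [h1, ← el_zero, el_inj] at hz
  exact hn hz.2.symm

/-- An automorphism of `Γ ⋊ ℤ` with finite Reidemeister number induces `-1` on `ℤ`, since the
identity of `ℤ` has infinitely many twisted conjugacy classes. -/
lemma exists_components (hfree : ∀ n : ℤ, n ≠ 0 → ∀ x : Γ, act α n x = x → x = 0)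
    (φ : MulAut (Multiplicative Γ ⋊[α] Multiplicative ℤ)) [Finite (ReidemeisterClasses φ)] :
    ∃ (p : Module.End ℤ Γ) (c : ℤ → Γ), ∀ x k, φ (el α x k) = el α (p x + c k) (-k) := by
  choose p hp using right_apply_el_zero hfree φ
  obtain ⟨z, e, he⟩ := exists_eq_el (φ (el α 0 1))
  let π : Multiplicative ℤ →* Multiplicative ℤ :=
    (SemidirectProduct.rightHom.comp φ.toMonoidHom).comp SemidirectProduct.inr
  have hπ : ∀ k : ℤ, toAdd (π (ofAdd k)) = k * e := by
    intro k
    have h1 : π (ofAdd 1) = ofAdd e := congrArg SemidirectProduct.right he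
    have h2 : ofAdd k = (ofAdd (1 : ℤ)) ^ k := by rw [← ofAdd_zsmul, zsmul_one, Int.cast_id]
    rw [h2, map_zpow, h1, ← ofAdd_zsmul, smul_eq_mul, toAdd_ofAdd]
  have hsplit : ∀ x k, el α x k = el α x 0 * el α 0 k := fun x k => by
    rw [el_mul, map_zero, add_zero, zero_add]
  have hφ : ∀ x k, φ (el α x k) = el α (p x + toAdd (φ (el α 0 k)).left) (k * e) := by
    intro x k
    have h1 : φ (el α 0 k) = el α (toAdd (φ (el α 0 k)).left) (k * e) := by
      rw [← hπ k]
      rfl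
    rw [hsplit, map_mul, hp]
    conv_lhs => rw [h1]
    rw [el_mul, act_zero_apply, zero_add]
  have he1 : e = -1 := by
    obtain ⟨g, hg⟩ := φ.surjective (el α 0 1)
    obtain ⟨x, k, rfl⟩ := exists_eq_el g
    rw [hφ, el_inj] at hg
    rcases Int.eq_one_or_neg_one_of_mul_eq_one' hg.2 with ⟨-, hone⟩ | h
    · exfalso
      have h1 : Function.Surjective (Quotient.lift (s := twistedConj φ)
          (fun g : Multiplicative Γ ⋊[α] Multiplicative ℤ => toAdd g.right) (by
            rintro g _ ⟨h, rfl⟩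
            obtain ⟨x, k, rfl⟩ := exists_eq_el g
            obtain ⟨y, l, rfl⟩ := exists_eq_el h
            rw [el_inv, hφ, el_mul, el_mul, hone]
            change k = l + k + -l * 1
            ring)) := fun k => ⟨Quotient.mk _ (el α 0 k), rfl⟩
      have := Finite.of_surjective _ h1
      exact not_finite ℤ
    · exact h.2
  have hpadd : ∀ x y, p (x + y) = p x + p y := by
    intro x y
    have h1 : el α (x + y) 0 = el α x 0 * el α y 0 := by
      rw [el_mul, act_zero_apply, add_zero]
    have h2 := congrArg φ h1
    rw [map_mul, hp, hp, hp, el_mul, act_zero_apply, el_inj] at h2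
    exact h2.1
  refine ⟨(AddMonoidHom.mk' p hpadd).toIntLinearMap, fun k => toAdd (φ (el α 0 k)).left,
    fun x k => ?_⟩
  rw [hφ, he1, mul_neg_one]
  rfl

section Components

variable {φ : MulAut (Multiplicative Γ ⋊[α] Multiplicative ℤ)} {p : Module.End ℤ Γ} {c : ℤ → Γ}

lemma cocycle_zero (hφ : ∀ x k, φ (el α x k) = el α (p x + c k) (-k)) : c 0 = 0 := by
  have h := hφ 0 0
  rw [el_zero, map_one, ← el_zero, el_inj] at h
  simpa using h.1.symm

lemma cocycle_add (hφ : ∀ x k, φ (el α x k) = el α (p x + c k) (-k)) (k l : ℤ) :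
    c (k + l) = c k + act α (-k) (c l) := by
  have h1 : el α (0 : Γ) (k + l) = el α 0 k * el α 0 l := by rw [el_mul, map_zero, add_zero]
  have h2 := congrArg φ h1
  rw [map_mul, hφ, hφ, hφ, el_mul, el_inj] at h2
  simpa using h2.1

lemma apply_act (hφ : ∀ x k, φ (el α x k) = el α (p x + c k) (-k)) (k : ℤ) :
    p * act α k = act α (-k) * p := by
  ext x
  have h1 : el α (0 : Γ) k * el α x 0 = el α (act α k x) k := by
    rw [el_mul, zero_add, add_zero]
  have h2 := congrArg φ h1
  rw [map_mul, hφ, hφ, hφ, el_mul, el_inj, cocycle_zero hφ, map_zero, zero_add, add_zero,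
    add_comm] at h2
  exact (add_right_cancel h2.1).symm

lemma twistedConj_el (hφ : ∀ x k, φ (el α x k) = el α (p x + c k) (-k)) (x y : Γ) (k l : ℤ) :
    (twistedConj φ).r (el α x k) (el α y l) ↔
      ∃ h j, y + act α l (p h + c j) = h + act α j x ∧ l = k + 2 * j := by
  have key : ∀ h j, el α y l = el α h j * el α x k * φ (el α h j)⁻¹ ↔
      y + act α l (p h + c j) = h + act α j x ∧ l = k + 2 * j := by
    intro h j
    rw [map_inv, eq_mul_inv_iff_mul_eq, hφ, el_mul, el_mul, el_inj]
    refine and_congr Iff.rfl ⟨fun h => by omega, fun h => by omega⟩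
  constructor
  · rintro ⟨g, hg⟩
    obtain ⟨h, j, rfl⟩ := exists_eq_el g
    exact ⟨h, j, (key h j).mp hg⟩
  · rintro ⟨h, j, hh⟩
    exact ⟨el α h j, (key h j).mpr hh⟩

/-- The classes of the elements `(x, k)` with `k` fixed are the cosets of the image of
`1 - act α k * p`, where `p` is the restriction of `φ` to `Γ`. -/
lemma finite_quotient_range (hφ : ∀ x k, φ (el α x k) = el α (p x + c k) (-k))
    [Finite (ReidemeisterClasses φ)] (k : ℤ) :
    Finite (Γ ⧸ LinearMap.range (1 - act α k * p)) := by
  refine Finite.of_injective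
    (fun q => (Quotient.mk (twistedConj φ) (el α q.out k) : ReidemeisterClasses φ)) ?_
  intro q r h
  obtain ⟨h, j, h1, h2⟩ :=
    (twistedConj_el hφ q.out r.out k k).mp (Quotient.exact (s := twistedConj φ) h)
  obtain rfl : j = 0 := by omega
  rw [cocycle_zero hφ, add_zero, act_zero_apply] at h1
  rw [← q.out_eq, ← r.out_eq]
  have h3 : r.out - q.out ∈ LinearMap.range (1 - act α k * p) := by
    refine ⟨h, ?_⟩
    change h - act α k (p h) = r.out - q.out
    rw [sub_eq_sub_iff_add_eq_add, ← h1, add_comm]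
  exact ((Submodule.Quotient.eq _).mpr h3).symm

lemma commute_act_add (hφ : ∀ x k, φ (el α x k) = el α (p x + c k) (-k)) :
    Commute p (act α 1 + act α (-1)) := by
  rw [Commute, SemiconjBy, mul_add, add_mul, apply_act hφ, apply_act hφ, neg_neg, add_comm]

/-- Conjugating by `j` turns the image of `1 - act α k * p` into that of
`1 - act α (k + 2 * j) * p`, so that the images for `k = 0` and `k = 1` control all others. -/
lemma le_range (hφ : ∀ x k, φ (el α x k) = el α (p x + c k) (-k)) {M : Submodule ℤ Γ}
    (hM : ∀ k, M ≤ M.comap (act α k)) (h0 : M ≤ LinearMap.range (1 - act α 0 * p))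
    (h1 : M ≤ LinearMap.range (1 - act α 1 * p)) (k : ℤ) :
    M ≤ LinearMap.range (1 - act α k * p) := by
  have key : ∀ i j, M ≤ LinearMap.range (1 - act α i * p) →
      M ≤ LinearMap.range (1 - act α (i + 2 * j) * p) := by
    intro i j hi y hy
    obtain ⟨x, hx⟩ := hi (hM (-j) hy)
    refine ⟨act α j x, ?_⟩
    have h2 : p (act α j x) = act α (-j) (p x) := LinearMap.congr_fun (apply_act hφ j) x
    have h3 : act α (i + 2 * j) (act α (-j) (p x)) = act α j (act α i (p x)) := by
      rw [← act_add_apply, ← act_add_apply]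
      ring_nf
    change act α j x - act α (i + 2 * j) (p (act α j x)) = y
    rw [h2, h3, ← map_sub]
    have h4 : x - act α i (p x) = act α (-j) y := hx
    rw [h4, act_act_neg]
  rcases Int.even_or_odd' k with ⟨j, rfl | rfl⟩
  · simpa using key 0 j h0
  · simpa [add_comm] using key 1 j h1

/-- The integers acting trivially on the quotient by a submodule of finite index include a
nonzero one. -/
lemma exists_ne_zero_act_sub_mem {M : Submodule ℤ Γ} (hM : ∀ k, M ≤ M.comap (act α k))
    [Finite (Γ ⧸ M)] : ∃ m : ℤ, m ≠ 0 ∧ ∀ k, m ∣ k → ∀ x, act α k x - x ∈ M := by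
  have : Finite (Module.End ℤ (Γ ⧸ M)) := DFunLike.finite _
  obtain ⟨a, b, hne, hab⟩ := Finite.exists_ne_map_eq_of_infinite
    fun k : ℤ => M.mapQ M (act α k) (hM k)
  have h1 : ∀ x, act α (a - b) x - x ∈ M := by
    intro x
    have h2 : act α a x - act α b x ∈ M :=
      (Submodule.Quotient.eq M).mp (LinearMap.congr_fun hab (M.mkQ x))
    have h3 := hM (-b) h2
    rw [Submodule.mem_comap, map_sub, act_neg_act, ← act_add_apply, neg_add_eq_sub] at h3
    exact h3
  let S : AddSubgroup ℤ :=
    { carrier := {k | ∀ x, act α k x - x ∈ M}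
      zero_mem' := fun x => by simp [act_zero_apply]
      add_mem' := fun {k l} hk hl x => by
        have h := M.add_mem (hk (act α l x)) (hl x)
        rwa [sub_add_sub_cancel, ← act_add_apply] at h
      neg_mem' := fun {k} hk x => by
        have h := M.neg_mem (hk (act α (-k) x))
        rwa [act_act_neg, neg_sub] at h }
  refine ⟨a - b, sub_ne_zero.mpr hne, ?_⟩
  rintro _ ⟨j, rfl⟩
  have h2 : a - b ∈ S := h1
  have h3 := S.zsmul_mem h2 j
  rw [smul_eq_mul, mul_comm] at h3
  exact h3

lemma cocycle_mem_of_dvd (hφ : ∀ x k, φ (el α x k) = el α (p x + c k) (-k)) {M : Submodule ℤ Γ}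
    (hM : ∀ k, M ≤ M.comap (act α k)) {m k : ℤ} (hm : c m ∈ M) (hk : m ∣ k) : c k ∈ M := by
  let S : AddSubgroup ℤ :=
    { carrier := {k | c k ∈ M}
      zero_mem' := by
        change c 0 ∈ M
        rw [cocycle_zero hφ]
        exact M.zero_mem
      add_mem' := fun {k l} hk hl => by
        change c (k + l) ∈ M
        rw [cocycle_add hφ]
        exact M.add_mem hk (hM _ hl)
      neg_mem' := fun {k} hk => by
        have h := cocycle_add hφ (-k) k
        rw [neg_add_cancel, cocycle_zero hφ, neg_neg] at h
        change c (-k) ∈ M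
        rw [eq_neg_of_add_eq_zero_left h.symm]
        exact M.neg_mem (hM _ hk) }
  obtain ⟨j, rfl⟩ := hk
  have h3 := S.zsmul_mem (x := m) hm j
  rw [smul_eq_mul, mul_comm] at h3
  exact h3

end Components

/-- Let `ℤ` act on `Γ` without nonzero vectors fixed by some `n ≠ 0`, and let `Γ` be
generated by a finitely generated subgroup `L` under the operator `act α 1 + act α (-1)`. Then
`Γ ⋊ ℤ` has the RP property. -/
theorem isRPGroup (hfree : ∀ n : ℤ, n ≠ 0 → ∀ x : Γ, act α n x = x → x = 0)
    (L : Submodule ℤ Γ) (hL : L.FG)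
    (hgen : ∀ Q : Submodule ℤ Γ, L ≤ Q → Q ≤ Q.comap (act α 1 + act α (-1)) → Q = ⊤) :
    IsRPGroup (Multiplicative Γ ⋊[α] Multiplicative ℤ) := by
  intro φ hR
  have : Finite (ReidemeisterClasses φ) := by
    by_contra h
    rw [not_finite_iff_infinite] at h
    exact hR (ENat.card_eq_top_of_infinite (α := ReidemeisterClasses φ))
  obtain ⟨p, c, hφ⟩ := exists_components hfree φ
  have hps := commute_act_add hφ
  have hts : ∀ k, Commute (act α k) (act α 1 + act α (-1)) := fun k =>
    (commute_act k 1).add_right (commute_act k (-1))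
  let H : ℤ → Submodule ℤ Γ := fun k => LinearMap.range (1 - act α k * p)
  have hHs : ∀ k, H k ≤ (H k).comap (act α 1 + act α (-1)) := by
    rintro k _ ⟨x, rfl⟩
    refine ⟨(act α 1 + act α (-1)) x, ?_⟩
    exact LinearMap.congr_fun ((Commute.one_left _).sub_left ((hts k).mul_left hps)).eq x
  have : Finite (Γ ⧸ (H 0 ⊓ H 1)) := by
    have := finite_quotient_range hφ 0
    have := finite_quotient_range hφ 1
    refine Finite.of_injective
      (fun q : Γ ⧸ (H 0 ⊓ H 1) => ((H 0).mkQ q.out, (H 1).mkQ q.out)) fun q r h => ?_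
    rw [← q.out_eq, ← r.out_eq]
    exact (Submodule.Quotient.eq _).mpr
      ⟨(Submodule.Quotient.eq _).mp (congrArg Prod.fst h),
        (Submodule.Quotient.eq _).mp (congrArg Prod.snd h)⟩
  obtain ⟨M, hMH, _, hM⟩ := exists_finite_quotient_le_of_commute (act α 1 + act α (-1)) L hL hgen
    (H 0 ⊓ H 1) fun x hx => ⟨hHs 0 hx.1, hHs 1 hx.2⟩
  have hMt := fun k => hM _ (hts k)
  have hMp := hM _ hps
  have hMr := le_range hφ hMt (hMH.trans inf_le_left) (hMH.trans inf_le_right)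
  obtain ⟨m, hm0, hm⟩ := exists_ne_zero_act_sub_mem hMt
  have := congruenceSubgroup_normal (hM := hMt) hm
  have := congruenceSubgroup_finiteIndex (hM := hMt) hm0
  -- A power of the generator `(0, 1)` of `ℤ` whose image under `φ` lies in the subgroup for `m`.
  obtain ⟨j, hj0, hmj, hcj⟩ : ∃ j : ℤ, j ≠ 0 ∧ m ∣ j ∧ c j ∈ M := by
    have h1 := (congruenceSubgroup M hMt m).pow_index_mem (φ (el α 0 1))
    rw [← map_pow, el_pow, mul_one, hφ, map_zero, zero_add, el_mem_congruenceSubgroup] at h1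
    exact ⟨_, Nat.cast_ne_zero.mpr Subgroup.FiniteIndex.index_ne_zero, (dvd_neg).mp h1.2, h1.1⟩
  have := congruenceSubgroup_normal (hM := hMt) (m := 2 * j) fun k hk =>
    hm k ((hmj.trans (dvd_mul_left j 2)).trans hk)
  have := congruenceSubgroup_finiteIndex (hM := hMt) (m := 2 * j) (by omega)
  refine exists_finite_quotient φ (congruenceSubgroup M hMt (2 * j)) ?_ ?_
  · intro g hg
    obtain ⟨x, k, rfl⟩ := exists_eq_el g
    rw [el_mem_congruenceSubgroup] at hg
    change φ (el α x k) ∈ congruenceSubgroup M hMt (2 * j)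
    rw [hφ, el_mem_congruenceSubgroup]
    exact ⟨M.add_mem (hMp hg.1)
      (cocycle_mem_of_dvd hφ hMt hcj ((dvd_mul_left j 2).trans hg.2)), (dvd_neg).mpr hg.2⟩
  · intro g n hn
    obtain ⟨x, k, rfl⟩ := exists_eq_el g
    obtain ⟨y, l, rfl⟩ := exists_eq_el n
    have hy : y ∈ M := hn.1
    obtain ⟨i, rfl⟩ : 2 * j ∣ l := hn.2
    -- Conjugation by `(0, j i)` moves `k` to `k + 2 j i` and changes `x` only by elements of `M`;
    -- these lie in the image of `1 - act α (k + 2 j i) * p`.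
    rw [el_mul, twistedConj_el hφ]
    have hji : j ∣ j * i := dvd_mul_right j i
    obtain ⟨h, hh⟩ := hMr (k + 2 * j * i) (M.sub_mem
      (M.add_mem (hMt k hy) (hMt (k + 2 * j * i) (cocycle_mem_of_dvd hφ hMt hcj hji)))
      (hm (j * i) (hmj.trans hji) x))
    refine ⟨h, j * i, ?_, by ring⟩
    change h - act α (k + 2 * j * i) (p h) = _ at hh
    rw [map_add]
    conv_rhs => rw [eq_add_of_sub_eq hh]
    abel

end IntSemidirect

/-! ### The wreath product -/

section Wreath

variable {A : Type*} [AddCommGroup A]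

open IntSemidirect Multiplicative

lemma act_wreathAction_apply (k : ℤ) (f : Multiplicative ℤ →₀ A) (i : Multiplicative ℤ) :
    act (wreathAction A (Multiplicative ℤ)) k f i = f ((ofAdd k)⁻¹ * i) := rfl

lemma act_wreathAction_single (k i : ℤ) (a : A) :
    act (wreathAction A (Multiplicative ℤ)) k (Finsupp.single (ofAdd i) a)
      = Finsupp.single (ofAdd (k + i)) a := by
  ext l
  simp only [act_wreathAction_apply, Finsupp.single_apply, eq_inv_mul_iff_mul_eq]
  rfl

lemma eq_zero_of_act_wreathAction_eq (n : ℤ) (hn : n ≠ 0) (f : Multiplicative ℤ →₀ A)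
    (hf : act (wreathAction A (Multiplicative ℤ)) n f = f) : f = 0 := by
  by_contra h
  obtain ⟨i, hi⟩ := Finsupp.ne_iff.mp h
  have h1 : ∀ j : ℕ, f (ofAdd (-(j * n)) * i) = f i := by
    intro j
    induction j with
    | zero => simp
    | succ j ih =>
      rw [← ih]
      conv_rhs => rw [← hf, act_wreathAction_apply]
      congr 1
      rw [← mul_assoc, ← ofAdd_neg, ← ofAdd_add]
      push_cast
      ring_nf
  have h2 : Function.Injective fun j : ℕ => ofAdd (-(j * n)) * i := by
    intro a b hab
    have h3 := neg_injective (ofAdd.injective (mul_right_cancel hab))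
    exact_mod_cast mul_right_cancel₀ hn h3
  have h3 : (Set.range fun j : ℕ => ofAdd (-(j * n)) * i) ⊆ f.support := by
    rintro _ ⟨j, rfl⟩
    rw [Finset.mem_coe, Finsupp.mem_support_iff, h1]
    exact hi
  exact Set.infinite_range_of_injective h2 (f.support.finite_toSet.subset h3)

/-- The summands with indices `0` and `1` generate `⨁ A` under the sum `s` of the two unit shifts:
`s A_i ⊆ A_{i + 1} + A_{i - 1}` moves a pair of adjacent summands by one step in each direction. -/
lemma eq_top_of_le_comap_act_wreathAction (Q : Submodule ℤ (Multiplicative ℤ →₀ A))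
    (h0 : ∀ a, Finsupp.single (ofAdd 0) a ∈ Q) (h1 : ∀ a, Finsupp.single (ofAdd 1) a ∈ Q)
    (hQ : Q ≤ Q.comap (act (wreathAction A (Multiplicative ℤ)) 1 +
      act (wreathAction A (Multiplicative ℤ)) (-1))) : Q = ⊤ := by
  have hs : ∀ (i : ℤ) (a : A), Finsupp.single (ofAdd i) a ∈ Q →
      Finsupp.single (ofAdd (1 + i)) a + Finsupp.single (ofAdd (-1 + i)) a ∈ Q := by
    intro i a h
    rw [← act_wreathAction_single, ← act_wreathAction_single]
    exact hQ h
  have key : ∀ (i : ℤ) (a : A),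
      Finsupp.single (ofAdd i) a ∈ Q ∧ Finsupp.single (ofAdd (i + 1)) a ∈ Q := by
    intro i a
    induction i using Int.induction_on with
    | zero => exact ⟨h0 a, h1 a⟩
    | succ i ih =>
      refine ⟨ih.2, ?_⟩
      have h := Q.sub_mem (hs _ a ih.2) ih.1
      rwa [show (-1 + ((i : ℤ) + 1)) = i by ring, add_sub_cancel_right, add_comm] at h
    | pred i ih =>
      rw [sub_add_cancel]
      refine ⟨?_, ih.1⟩
      have h := Q.sub_mem (hs _ a ih.1) ih.2
      rwa [add_comm 1 (-(i : ℤ)), add_sub_cancel_left, neg_add_eq_sub] at h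
  rw [eq_top_iff]
  intro f _
  induction f using Finsupp.induction_linear with
  | zero => exact Q.zero_mem
  | add f g hf hg => exact Q.add_mem (hf trivial) (hg trivial)
  | single i a => exact (key (toAdd i) a).1

end Wreath

theorem theorem1 (A : Type*) [AddCommGroup A] [AddGroup.FG A] :
    IsRPGroup (WreathProduct A (Multiplicative ℤ)) ∧
      ∀ φ : MulAut (WreathProduct A (Multiplicative ℤ)),
        reidemeisterNumber φ ≠ ⊤ → reidemeisterNumber φ = fixedIrrepNumber φ := by
  have : Module.Finite ℤ A := Module.Finite.iff_addGroup_fg.mpr inferInstance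
  have hRP : IsRPGroup (WreathProduct A (Multiplicative ℤ)) := by
    refine IntSemidirect.isRPGroup eq_zero_of_act_wreathAction_eq
      (LinearMap.range (Finsupp.lsingle (M := A) (R := ℤ) (Multiplicative.ofAdd (0 : ℤ))) ⊔
        LinearMap.range (Finsupp.lsingle (M := A) (R := ℤ) (Multiplicative.ofAdd (1 : ℤ)))) ?_ ?_
    · rw [LinearMap.range_eq_map, LinearMap.range_eq_map]
      exact (Module.Finite.fg_top.map _).sup (Module.Finite.fg_top.map _)
    · intro Q hLQ hQ
      exact eq_top_of_le_comap_act_wreathAction Q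
        (fun a => hLQ (Submodule.mem_sup_left ⟨a, rfl⟩))
        (fun a => hLQ (Submodule.mem_sup_right ⟨a, rfl⟩)) hQ
  exact ⟨hRP, fun φ hφ => hRP.reidemeisterNumber_eq φ hφ⟩
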